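/- Let $k$ be a field and $N\ge 2$. Let $Q$ be the cyclic quiver with vertices $1,\dots,N$ (indices modulo $N$) and one arrow $\alpha_i\colon i\to i+1$ for each $i$. Let $\Lambda=kQ/\langle \mathrm{REL}\rangle$ be a cyclic Nakayama algebra, where $\mathrm{REL}$ is a nonempty finite irredundant set of paths of length at least $2$ (no path of $\mathrm{REL}$ is a subpath of another one). The product in $kQ$ of two paths $p$, $q$ is "$p$ followed by $q$" (and $0$ if $p$ does not end where $q$ starts), and modules are right modules. For each vertex $i$ let $e_i$ be the corresponding primitive idempotent, $P_i=e_i\Lambda$ the indecomposable projective module (spanned by the paths starting at $i$) and $S_i=P_i/\operatorname{rad}P_i$. Put $$\mathcal S(\Lambda)=\{\,j : S_j\cong\operatorname{soc}P_i\text{ for some vertex } i\,\},\qquad \mathcal S'(\Lambda)=\{\,j+1 : j\in\mathcal S(\Lambda)\,\},$$ and let $\varepsilon(\Lambda)=\operatorname{End}_\Lambda\bigl(\bigoplus_{i\in\mathcal S'(\Lambda)}P_i\bigr)$ be the syzygy filtered algebra of $\Lambda$. Then $\Lambda\cong\varepsilon(\Lambda)$ as $k$-algebras if and only if $\Lambda$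 is self-injective, i.e. $\Lambda$ is injective as a (right) module over itself. -/

import Mathlib

open scoped DirectSum

universe u

noncomputable section

namespace CyclicNakayama

/-- A path of the cyclic quiver `Q` with vertex set `ZMod N` and exactly one arrow
`α i : i ⟶ i + 1` for every vertex `i`.  A path is determined by its source and its length:
`⟨i, n⟩` is the path `i ⟶ i + 1 ⟶ ⋯ ⟶ i + n`, that is `α (i + n - 1) ⋯ α (i + 1) α i`. -/
@[ext]
structure CPath (N : ℕ) where
  source : ZMod N
  length : ℕ

/-- The end point of a path. -/
def CPath.target {N : ℕ} (p : CPath N) : ZMod N := p.source + (p.length : ZMod N)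

/-- `p` is a subpath of `q`: starting `a` steps after the source of `q`, the path `p` runs inside
`q`. -/
def CPath.IsSubpath {N : ℕ} (p q : CPath N) : Prop :=
  ∃ a : ℕ, p.source = q.source + (a : ZMod N) ∧ a + p.length ≤ q.length

/-- The path algebra `k Q` of the cyclic quiver: the vector space with basis the paths of `Q`. -/
def PathAlgebra (k : Type u) [Field k] (N : ℕ) : Type u := CPath N →₀ k

namespace PathAlgebra

variable (k : Type u) [Field k] (N : ℕ)

instance : AddCommGroup (PathAlgebra k N) := inferInstanceAs (AddCommGroup (CPath N →₀ k))

instance : Module k (PathAlgebra k N) := inferInstanceAs (Module k (CPath N →₀ k))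

variable {N}

/-- The basis element given by a path. -/
def path (p : CPath N) : PathAlgebra k N := Finsupp.single p (1 : k)

open Classical in
/-- The product of two paths: `p` followed by `q` if `q` starts where `p` ends, and `0`
otherwise. -/
def pathMul (p q : CPath N) : PathAlgebra k N :=
  if p.target = q.source then path k ⟨p.source, p.length + q.length⟩ else 0

variable (N)

/-- The bilinear extension of the product of paths. -/
def mulHom : PathAlgebra k N →ₗ[k] PathAlgebra k N →ₗ[k] PathAlgebra k N :=
  Finsupp.linearCombination k fun p : CPath N =>
    (Finsupp.linearCombination k fun q : CPath N => pathMul k p q :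
      (CPath N →₀ k) →ₗ[k] PathAlgebra k N)

instance : Mul (PathAlgebra k N) := ⟨fun x y => mulHom k N x y⟩

/-- The identity is the sum of all paths of length `0`. -/
instance [NeZero N] : One (PathAlgebra k N) := ⟨∑ i : ZMod N, path k ⟨i, 0⟩⟩

variable {k N}

theorem mul_eq (x y : PathAlgebra k N) : x * y = mulHom k N x y := rfl

theorem one_eq [NeZero N] : (1 : PathAlgebra k N) = ∑ i : ZMod N, path k ⟨i, 0⟩ := rfl

theorem path_mul_path (p q : CPath N) : path k p * path k q = pathMul k p q := by
  have h1 : mulHom k N (path k p) =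
      (Finsupp.linearCombination k fun q : CPath N => pathMul k p q) :=
    (Finsupp.linearCombination_single k (1 : k) p).trans (one_smul k _)
  rw [mul_eq, h1]
  exact (Finsupp.linearCombination_single k (1 : k) q).trans (one_smul k _)

/-- Two linear maps that agree on all paths are equal. -/
theorem hom_ext {M : Type*} [AddCommMonoid M] [Module k M] {f g : PathAlgebra k N →ₗ[k] M}
    (h : ∀ p, f (path k p) = g (path k p)) : f = g :=
  Finsupp.lhom_ext' fun p => LinearMap.ext_ring (h p)

theorem pathMul_assoc (p q r : CPath N) :
    mulHom k N (pathMul k p q) (path k r) = mulHom k N (path k p) (pathMul k q r) := by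
  unfold pathMul
  split_ifs with h1 h2 h2
  · rw [← mul_eq, ← mul_eq, path_mul_path, path_mul_path]
    unfold pathMul
    rw [if_pos, if_pos]
    · simp [add_assoc]
    · exact h1
    · simp only [CPath.target] at *
      rw [← h2, ← h1]; push_cast; ring
  · rw [← mul_eq, path_mul_path, map_zero]
    unfold pathMul
    rw [if_neg]
    intro h3
    apply h2
    simp only [CPath.target] at *
    rw [← h3, ← h1]; push_cast; ring
  · rw [← mul_eq, ← mul_eq, path_mul_path]
    unfold pathMul
    rw [if_neg]
    · rw [mul_eq, map_zero, LinearMap.zero_apply]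
    · exact h1
  · simp

theorem mul_assoc' (x y z : PathAlgebra k N) : x * y * z = x * (y * z) := by
  have h : ∀ p q : CPath N, mulHom k N (mulHom k N (path k p) (path k q)) =
      (mulHom k N (path k p)).comp (mulHom k N (path k q)) := by
    intro p q
    refine hom_ext fun r => ?_
    have h1 := pathMul_assoc (k := k) p q r
    rw [← path_mul_path, ← path_mul_path] at h1
    exact h1
  have h2 : ∀ p : CPath N, (mulHom k N).comp (mulHom k N (path k p)) =
      (LinearMap.llcomp k _ _ _ (mulHom k N (path k p))).comp (mulHom k N) :=
    fun p => hom_ext fun q => h p q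
  have h3 : (LinearMap.llcomp k _ _ _ (mulHom k N)).comp (mulHom k N) =
      (LinearMap.lcomp k _ (mulHom k N)).comp
        ((LinearMap.llcomp k (PathAlgebra k N) (PathAlgebra k N) (PathAlgebra k N)).comp
          (mulHom k N)) :=
    hom_ext fun p => h2 p
  exact LinearMap.congr_fun (LinearMap.congr_fun (LinearMap.congr_fun h3 x) y) z

theorem one_mul' [NeZero N] (x : PathAlgebra k N) : 1 * x = x := by
  have h : mulHom k N 1 = LinearMap.id := by
    refine hom_ext fun p => ?_
    rw [← mul_eq, one_eq, mul_eq, map_sum, LinearMap.sum_apply]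
    simp only [← mul_eq, path_mul_path]
    simp [pathMul, CPath.target]
  exact LinearMap.congr_fun h x

theorem mul_one' [NeZero N] (x : PathAlgebra k N) : x * 1 = x := by
  have h : (mulHom k N).flip 1 = LinearMap.id := by
    refine hom_ext fun p => ?_
    rw [LinearMap.flip_apply, one_eq, map_sum]
    simp only [← mul_eq, path_mul_path]
    simp [pathMul]
  exact LinearMap.congr_fun h x

instance [NeZero N] : Ring (PathAlgebra k N) :=
  { (inferInstance : AddCommGroup (PathAlgebra k N)) with
    mul := (· * ·)
    one := 1
    mul_assoc := mul_assoc'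
    one_mul := one_mul'
    mul_one := mul_one'
    zero_mul := fun x => by
      show mulHom k N 0 x = 0
      rw [map_zero, LinearMap.zero_apply]
    mul_zero := fun x => map_zero (mulHom k N x)
    left_distrib := fun x y z => map_add (mulHom k N x) y z
    right_distrib := fun x y z => by
      show mulHom k N (x + y) z = mulHom k N x z + mulHom k N y z
      rw [map_add, LinearMap.add_apply] }

instance [NeZero N] : Algebra k (PathAlgebra k N) :=
  Algebra.ofModule
    (fun r x y => by
      show mulHom k N (r • x) y = r • mulHom k N x y
      rw [map_smul, LinearMap.smul_apply])
    (fun r x y => map_smul (mulHom k N x) r y)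

end PathAlgebra

/-- An irredundant system of relations on the cyclic quiver with `N` vertices: a nonempty finite
set of paths of length at least `2`, none of which is a subpath of another one. -/
structure Relations (N : ℕ) where
  rels : Finset (CPath N)
  nonempty : rels.Nonempty
  two_le_length : ∀ p ∈ rels, 2 ≤ p.length
  irredundant : ∀ p ∈ rels, ∀ q ∈ rels, p.IsSubpath q → p = q

section Algebras

variable (k : Type u) [Field k] {N : ℕ} [NeZero N] (R : Relations N)

/-- The two-sided ideal of the path algebra generated by the relations. -/
def relIdeal : TwoSidedIdeal (PathAlgebra k N) :=
  TwoSidedIdeal.span {x | ∃ p ∈ R.rels, x = PathAlgebra.path k p}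

/-- The cyclic Nakayama algebra `Λ = k Q / ⟨relations⟩`. -/
def NakayamaAlgebra : Type u := (relIdeal k R).ringCon.Quotient

instance : Ring (NakayamaAlgebra k R) := inferInstanceAs (Ring (relIdeal k R).ringCon.Quotient)

instance : Algebra k (NakayamaAlgebra k R) :=
  inferInstanceAs (Algebra k (relIdeal k R).ringCon.Quotient)

/-- The quotient map `k Q → Λ`. -/
def toNakayama : PathAlgebra k N →ₐ[k] NakayamaAlgebra k R := (relIdeal k R).ringCon.mkₐ k

/-- The primitive idempotent `e i` of `Λ` at the vertex `i`. -/
def idem (i : ZMod N) : NakayamaAlgebra k R := toNakayama k R (PathAlgebra.path k ⟨i, 0⟩)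

/-- The indecomposable projective right `Λ`-module `P i = e i Λ`, which is spanned by the paths
with source `i`.  Right `Λ`-modules are modules over `Λᵐᵒᵖ`. -/
def proj (i : ZMod N) : Submodule (NakayamaAlgebra k R)ᵐᵒᵖ (NakayamaAlgebra k R) :=
  Submodule.span (NakayamaAlgebra k R)ᵐᵒᵖ {idem k R i}

/-- The simple right `Λ`-module `S i`, the quotient of `P i` by its radical. -/
abbrev simpleModule (i : ZMod N) : Type u :=
  proj k R i ⧸ Module.jacobson (NakayamaAlgebra k R)ᵐᵒᵖ (proj k R i)

/-- The socle of a module: the sum of its simple submodules. -/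
def socle (A : Type*) [Ring A] (M : Type*) [AddCommGroup M] [Module A M] : Submodule A M :=
  sSup {T : Submodule A M | IsSimpleModule A T}

/-- The set `𝒮(Λ)` of the simple modules that are socles of indecomposable projective modules, as
a set of vertices: `j` belongs to it if `S j` is isomorphic to the socle of some `P i`. -/
def socleVertices : Set (ZMod N) :=
  {j | ∃ i, Nonempty (socle (NakayamaAlgebra k R)ᵐᵒᵖ (proj k R i)
    ≃ₗ[(NakayamaAlgebra k R)ᵐᵒᵖ] simpleModule k R j)}

/-- The set `𝒮'(Λ)`: the vertices that come cyclically right after those of `𝒮(Λ)`. -/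
def shiftedSocleVertices : Set (ZMod N) := (fun j => j + 1) '' socleVertices k R

/-- The syzygy filtered algebra `ε(Λ)`: the endomorphism algebra of the direct sum of the
projective right `Λ`-modules `P i`, `i ∈ 𝒮'(Λ)`. -/
abbrev SyzygyFilteredAlgebra : Type u :=
  Module.End (NakayamaAlgebra k R)ᵐᵒᵖ (⨁ i : shiftedSocleVertices k R, proj k R i)

end Algebras

end CyclicNakayama

end

noncomputable section

namespace CyclicNakayama

/-! ### Paths avoiding the relations -/

section Paths

variable {N : ℕ} (R : Relations N)

/-! Write c_i = `projLength i` for the length of P_i. The relation ideal is monomial, so the paths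
avoiding all relations give a basis of Λ (`mem_relIdeal_iff`), and computations are done on
coefficients in that basis. The socle of P_i is spanned by its longest path, ending at i + c_i - 1 =
`socleVertex i`, and c_i ≤ c_{i+1} + 1 always. Both sides of the equivalence amount to c being
constant.

If Λ ≅ ε(Λ): the sum of the P_i over 𝒮' is a right ideal eΛ, and its endomorphisms are determined by
the image of e. So Λ embeds k-linearly in eΛ ⊆ Λ, and finite dimension forces 𝒮' to be everything
(`eq_univ_of_algEquiv`). Then `socleVertex` is a permutation, which excludes c_i = c_{i+1} + 1;
hence c cannot drop around the cycle and is constant. For constant c, the sum of the coefficients of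
the longest paths is a Frobenius form, so Λ is self-injective.

If Λ is self-injective: c_i = c_{i+1} + 1 would make left multiplication by α_i injective on
P_{i+1}, and extending the inclusion of P_{i+1} along it would write e_{i+1} as a left multiple of
α_i (`ne_succ_of_injective`). So c is constant, `socleVertex` is a translation, 𝒮' is everything,
and ε(Λ) ≅ End(Λ_Λ) ≅ Λ. -/

/-- A path is nonzero in the Nakayama algebra if no relation is a subpath of it. -/
def Relations.Avoids (p : CPath N) : Prop := ∀ r ∈ R.rels, ¬ r.IsSubpath p

variable {R}

theorem CPath.IsSubpath.trans {p q r : CPath N} (hpq : p.IsSubpath q) (hqr : q.IsSubpath r) :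
    p.IsSubpath r := by
  obtain ⟨a, ha, ha'⟩ := hpq
  obtain ⟨b, hb, hb'⟩ := hqr
  refine ⟨b + a, ?_, by omega⟩
  rw [ha, hb]; push_cast; ring

theorem Relations.Avoids.of_isSubpath {p q : CPath N} (hq : R.Avoids q) (h : p.IsSubpath q) :
    R.Avoids p := fun r hr hrp => hq r hr (hrp.trans h)

theorem isSubpath_prefix (i : ZMod N) {m n : ℕ} (h : m ≤ n) :
    CPath.IsSubpath ⟨i, m⟩ ⟨i, n⟩ := ⟨0, by simp, by simpa using h⟩

theorem isSubpath_suffix (i : ZMod N) (m n : ℕ) :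
    CPath.IsSubpath ⟨i + (m : ZMod N), n⟩ ⟨i, m + n⟩ := ⟨m, rfl, le_rfl⟩

variable (R)

theorem avoids_trivial (i : ZMod N) : R.Avoids ⟨i, 0⟩ := by
  rintro r hr ⟨a, -, ha⟩
  have := R.two_le_length r hr
  simp only at ha
  omega

/-- Walk from `i` to the source of some relation, then along it. Nonemptiness of the relations
enters here and makes Λ finite-dimensional. -/
theorem exists_not_avoids [NeZero N] (i : ZMod N) : ∃ n, ¬ R.Avoids ⟨i, n⟩ := by
  obtain ⟨r, hr⟩ := R.nonempty
  refine ⟨(r.source - i).val + r.length, fun h => h r hr ⟨(r.source - i).val, ?_, le_rfl⟩⟩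
  simp

open Classical in
/-- The number of paths with source `i` that are nonzero in the Nakayama algebra, that is the
length of the projective module `P i`. -/
def Relations.projLength [NeZero N] (i : ZMod N) : ℕ := Nat.find (exists_not_avoids R i)

variable [NeZero N]

theorem avoids_iff (i : ZMod N) (n : ℕ) : R.Avoids ⟨i, n⟩ ↔ n < R.projLength i := by
  classical
  constructor
  · intro h
    by_contra hn
    exact Nat.find_spec (exists_not_avoids R i) (h.of_isSubpath (isSubpath_prefix i (not_lt.1 hn)))
  · intro h
    exact not_not.1 (Nat.find_min (exists_not_avoids R i) h)

theorem projLength_pos (i : ZMod N) : 0 < R.projLength i := (avoids_iff R i 0).1 (avoids_trivial R i)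

/-- Removing the first arrow of a nonzero path leaves a nonzero path. -/
theorem projLength_le_succ (i : ZMod N) : R.projLength i ≤ R.projLength (i + 1) + 1 := by
  by_contra h
  have h1 : R.Avoids ⟨i, 1 + R.projLength (i + 1)⟩ := (avoids_iff R _ _).2 (by omega)
  have h2 := h1.of_isSubpath (isSubpath_suffix i 1 (R.projLength (i + 1)))
  rw [Nat.cast_one, avoids_iff] at h2
  exact lt_irrefl _ h2

/-- The end point of the longest nonzero path with source `i`. -/
def Relations.socleVertex (i : ZMod N) : ZMod N := i + ((R.projLength i - 1 : ℕ) : ZMod N)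

theorem socleVertex_add_one (i : ZMod N) :
    R.socleVertex i + 1 = i + (R.projLength i : ZMod N) := by
  have := projLength_pos R i
  obtain ⟨c, hc⟩ := Nat.exists_eq_succ_of_ne_zero this.ne'
  rw [Relations.socleVertex, hc]
  push_cast; simp [add_assoc]

/-- Without drops by one, `projLength_le_succ` makes the lengths weakly increasing, and going around
the cycle returns to the start. -/
theorem projLength_eq_of_ne_succ (h : ∀ i, R.projLength i ≠ R.projLength (i + 1) + 1)
    (i j : ZMod N) : R.projLength i = R.projLength j := by
  have key : ∀ i j, R.projLength i ≤ R.projLength j := by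
    intro i j
    have step : ∀ m : ℕ, R.projLength i ≤ R.projLength (i + (m : ZMod N)) := by
      intro m
      induction m with
      | zero => simp
      | succ m ih =>
        have h1 := projLength_le_succ R (i + (m : ZMod N))
        have h2 := h (i + (m : ZMod N))
        rw [add_assoc] at h1 h2
        push_cast
        omega
    have := step (j - i).val
    simpa using this
  exact le_antisymm (key i j) (key j i)

/-- With such a drop, the longest path from `i` is α_i followed by the longest path from `i + 1`, so
both end at the same vertex; `2 ≤ N` keeps `i` and `i + 1` distinct. -/
theorem ne_succ_of_socleVertex_injective (hN : 2 ≤ N) (h : Function.Injective R.socleVertex)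
    (i : ZMod N) : R.projLength i ≠ R.projLength (i + 1) + 1 := by
  intro hi
  have h1 : R.socleVertex i = R.socleVertex (i + 1) := by
    apply add_right_cancel (b := (1 : ZMod N))
    rw [socleVertex_add_one, socleVertex_add_one, hi]
    push_cast; ring
  have h2 := h h1
  have : Fact (1 < N) := ⟨hN⟩
  exact one_ne_zero (α := ZMod N) (by simpa using h2.symm)

end Paths

/-! ### Coefficients of elements of the path algebra and of the Nakayama algebra -/

namespace PathAlgebra

variable {k : Type u} [Field k] {N : ℕ}

/-- The coefficient of a path in an element of the path algebra. -/
def coeff (p : CPath N) : PathAlgebra k N →ₗ[k] k := Finsupp.lapply (R := k) p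

open Classical in
theorem coeff_path (p q : CPath N) :
    coeff p (path k q) = if q = p then (1 : k) else 0 := Finsupp.single_apply

theorem eq_sum (x : PathAlgebra k N) :
    ∃ s : Finset (CPath N), x = ∑ p ∈ s, coeff p x • path k p := by
  refine ⟨Finsupp.support x, ?_⟩
  have h2 : (Finsupp.linearCombination k fun p : CPath N => path k p :
      (CPath N →₀ k) →ₗ[k] PathAlgebra k N) = (LinearMap.id : PathAlgebra k N →ₗ[k] _) :=
    hom_ext fun p => (Finsupp.linearCombination_single k (1 : k) p).trans (one_smul k _)
  exact (LinearMap.congr_fun h2 x).symm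

end PathAlgebra

open PathAlgebra

section Coefficients

variable {k : Type u} [Field k] {N : ℕ} [NeZero N] {R : Relations N}

theorem path_mem_relIdeal {p : CPath N} (hp : ¬ R.Avoids p) : path k p ∈ relIdeal k R := by
  simp only [Relations.Avoids, not_forall, not_not] at hp
  obtain ⟨r, hr, a, ha, hle⟩ := hp
  obtain ⟨b, hb⟩ := Nat.exists_eq_add_of_le hle
  have h1 : path k r ∈ relIdeal k R := TwoSidedIdeal.subset_span ⟨r, hr, rfl⟩
  have h2 := (relIdeal k R).mul_mem_right _ (path k ⟨r.target, b⟩)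
    ((relIdeal k R).mul_mem_left (path k ⟨p.source, a⟩) _ h1)
  rw [path_mul_path, pathMul, if_pos (by simp [CPath.target, ha]), path_mul_path, pathMul,
    if_pos (by simp [CPath.target, ha, add_assoc])] at h2
  convert h2

variable (k R) in
/-- The span of the paths that contain a relation. -/
def zeroPathSpan : Submodule k (PathAlgebra k N) :=
  Submodule.span k {x | ∃ p, ¬ R.Avoids p ∧ x = path k p}

theorem mul_mem_zeroPathSpan (x : PathAlgebra k N) {y : PathAlgebra k N}
    (hy : y ∈ zeroPathSpan k R) : x * y ∈ zeroPathSpan k R := by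
  suffices h : zeroPathSpan k R ≤ (zeroPathSpan k R).comap (mulHom k N x) from h hy
  refine Submodule.span_le.2 ?_
  rintro _ ⟨q, hq, rfl⟩
  -- Membership is recast as vanishing of a linear map to the quotient, so that it can be tested on
  -- paths.
  suffices h : (zeroPathSpan k R).mkQ ∘ₗ (mulHom k N).flip (path k q) = 0 from
    (Submodule.Quotient.mk_eq_zero (zeroPathSpan k R)).1 (LinearMap.congr_fun h x)
  refine hom_ext fun p => (Submodule.Quotient.mk_eq_zero _).2 ?_
  rw [LinearMap.flip_apply, ← mul_eq, path_mul_path, pathMul]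
  split_ifs with h
  · refine Submodule.subset_span ⟨_, fun hp => hq (hp.of_isSubpath ?_), rfl⟩
    exact ⟨p.length, h.symm, le_rfl⟩
  · exact zero_mem _

theorem mul_mem_zeroPathSpan' {x : PathAlgebra k N} (y : PathAlgebra k N)
    (hx : x ∈ zeroPathSpan k R) : x * y ∈ zeroPathSpan k R := by
  suffices h : zeroPathSpan k R ≤ (zeroPathSpan k R).comap ((mulHom k N).flip y) from h hx
  refine Submodule.span_le.2 ?_
  rintro _ ⟨p, hp, rfl⟩
  suffices h : (zeroPathSpan k R).mkQ ∘ₗ mulHom k N (path k p) = 0 from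
    (Submodule.Quotient.mk_eq_zero (zeroPathSpan k R)).1 (LinearMap.congr_fun h y)
  refine hom_ext fun q => (Submodule.Quotient.mk_eq_zero _).2 ?_
  rw [← mul_eq, path_mul_path, pathMul]
  split_ifs with h
  · refine Submodule.subset_span ⟨_, fun hq => hp (hq.of_isSubpath ?_), rfl⟩
    exact isSubpath_prefix _ (Nat.le_add_right _ _)
  · exact zero_mem _

/-- The span of the paths containing a relation is itself a two-sided ideal, so it contains the
ideal generated by the relations. -/
theorem coeff_eq_zero_of_mem_relIdeal {x : PathAlgebra k N} (hx : x ∈ relIdeal k R)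
    {p : CPath N} (hp : R.Avoids p) : coeff p x = 0 := by
  have h1 : x ∈ zeroPathSpan k R := by
    let I : TwoSidedIdeal (PathAlgebra k N) := TwoSidedIdeal.mk' (zeroPathSpan k R)
      (zero_mem _) (fun h h' => add_mem h h') (fun h => neg_mem h)
      (fun h => mul_mem_zeroPathSpan _ h) (fun h => mul_mem_zeroPathSpan' _ h)
    have hI : relIdeal k R ≤ I := by
      refine TwoSidedIdeal.span_le.2 ?_
      rintro _ ⟨r, hr, rfl⟩
      rw [SetLike.mem_coe, TwoSidedIdeal.mem_mk']
      exact Submodule.subset_span ⟨r, fun h => h r hr ⟨0, by simp, by simp⟩, rfl⟩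
    have := hI hx
    rwa [TwoSidedIdeal.mem_mk'] at this
  suffices h : zeroPathSpan k R ≤ LinearMap.ker (coeff p) from h h1
  refine Submodule.span_le.2 ?_
  rintro _ ⟨q, hq, rfl⟩
  rw [SetLike.mem_coe, LinearMap.mem_ker, coeff_path, if_neg]
  rintro rfl
  exact hq hp

theorem mem_relIdeal_iff {x : PathAlgebra k N} :
    x ∈ relIdeal k R ↔ ∀ p, R.Avoids p → coeff p x = 0 := by
  refine ⟨fun hx p hp => coeff_eq_zero_of_mem_relIdeal hx hp, fun h => ?_⟩
  obtain ⟨s, hs⟩ := eq_sum x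
  rw [hs]
  refine sum_mem fun p _ => ?_
  by_cases hp : R.Avoids p
  · rw [h p hp, zero_smul]
    exact zero_mem _
  -- Scalars are absorbed as left factors, since a two-sided ideal is only known to be closed under
  -- ring multiplication.
  · have h1 := (relIdeal k R).mul_mem_left (algebraMap k _ (coeff p x)) _
      (path_mem_relIdeal (k := k) hp)
    rwa [← Algebra.smul_def] at h1

theorem toNakayama_surjective : Function.Surjective (toNakayama k R) :=
  RingCon.mkₐ_surjective _

theorem toNakayama_eq_zero_iff {x : PathAlgebra k N} :
    toNakayama k R x = 0 ↔ x ∈ relIdeal k R := by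
  have h : toNakayama k R x = toNakayama k R 0 ↔ (relIdeal k R).ringCon x 0 := RingCon.eq _
  rw [map_zero, TwoSidedIdeal.rel_iff, sub_zero] at h
  exact h

variable (k R) in
/-- The image of a path in the Nakayama algebra. -/
def pathClass (p : CPath N) : NakayamaAlgebra k R := toNakayama k R (path k p)

theorem idem_eq (i : ZMod N) : idem k R i = pathClass k R ⟨i, 0⟩ := rfl

theorem pathClass_eq_zero {p : CPath N} (hp : ¬ R.Avoids p) : pathClass k R p = 0 :=
  toNakayama_eq_zero_iff.2 (path_mem_relIdeal hp)

theorem pathClass_mul_pathClass (i : ZMod N) (m n : ℕ) :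
    pathClass k R ⟨i, m⟩ * pathClass k R ⟨i + (m : ZMod N), n⟩ = pathClass k R ⟨i, m + n⟩ := by
  rw [pathClass, pathClass, ← map_mul, path_mul_path, pathMul, if_pos (by rfl)]
  rfl

theorem pathClass_mul_pathClass_of_ne {i j : ZMod N} {m n : ℕ} (h : i + (m : ZMod N) ≠ j) :
    pathClass k R ⟨i, m⟩ * pathClass k R ⟨j, n⟩ = 0 := by
  rw [pathClass, pathClass, ← map_mul, path_mul_path, pathMul, if_neg (by exact h), map_zero]

theorem one_eq_sum_idem : (1 : NakayamaAlgebra k R) = ∑ i, idem k R i := by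
  rw [← map_one (toNakayama k R), one_eq, map_sum]
  rfl

theorem hom_ext_pathClass {M : Type*} [AddCommGroup M] [Module k M]
    {f g : NakayamaAlgebra k R →ₗ[k] M} (h : ∀ p, f (pathClass k R p) = g (pathClass k R p)) :
    f = g := by
  have h1 : f ∘ₗ (toNakayama k R).toLinearMap = g ∘ₗ (toNakayama k R).toLinearMap := hom_ext h
  ext x
  obtain ⟨x, rfl⟩ := toNakayama_surjective x
  exact LinearMap.congr_fun h1 x

open Classical in
variable (k R) in
/-- The coefficient of a path that avoids the relations in an element of the Nakayama algebra;
it is `0` for the other paths. -/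
def ncoeff (p : CPath N) : NakayamaAlgebra k R →ₗ[k] k :=
  if hp : R.Avoids p then
    ((LinearMap.ker (toNakayama k R).toLinearMap).liftQ (coeff p) fun _ hx =>
      coeff_eq_zero_of_mem_relIdeal (toNakayama_eq_zero_iff.1 hx) hp) ∘ₗ
      ((toNakayama k R).toLinearMap.quotKerEquivOfSurjective toNakayama_surjective).symm.toLinearMap
  else 0

theorem ncoeff_toNakayama {p : CPath N} (hp : R.Avoids p) (x : PathAlgebra k N) :
    ncoeff k R p (toNakayama k R x) = coeff p x := by
  have h : ((toNakayama k R).toLinearMap.quotKerEquivOfSurjective toNakayama_surjective).symm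
      (toNakayama k R x) = Submodule.Quotient.mk x := (LinearEquiv.symm_apply_eq _).2 rfl
  rw [ncoeff, dif_pos hp, LinearMap.comp_apply, LinearEquiv.coe_coe, h]
  rfl

theorem ncoeff_of_not_avoids {p : CPath N} (hp : ¬ R.Avoids p) (x : NakayamaAlgebra k R) :
    ncoeff k R p x = 0 := by
  rw [ncoeff, dif_neg hp, LinearMap.zero_apply]

open Classical in
theorem ncoeff_pathClass {p : CPath N} (hp : R.Avoids p) (q : CPath N) :
    ncoeff k R p (pathClass k R q) = if q = p then 1 else 0 := by
  rw [pathClass, ncoeff_toNakayama hp, coeff_path]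

theorem nakayama_ext {x y : NakayamaAlgebra k R}
    (h : ∀ p, R.Avoids p → ncoeff k R p x = ncoeff k R p y) : x = y := by
  rw [← sub_eq_zero]
  obtain ⟨z, hz⟩ := toNakayama_surjective (x - y)
  rw [← hz, toNakayama_eq_zero_iff, mem_relIdeal_iff]
  intro p hp
  rw [← ncoeff_toNakayama hp, hz, map_sub, h p hp, sub_self]

/-- Right multiplication by a path `q` shifts the coefficients of paths that end with `q`. -/
theorem ncoeff_mul_pathClass {s : ZMod N} {n m : ℕ} (h : R.Avoids ⟨s, n + m⟩)
    (x : NakayamaAlgebra k R) :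
    ncoeff k R ⟨s, n + m⟩ (x * pathClass k R ⟨s + (n : ZMod N), m⟩) = ncoeff k R ⟨s, n⟩ x := by
  classical
  suffices h : ncoeff k R ⟨s, n + m⟩ ∘ₗ LinearMap.mulRight k (pathClass k R ⟨s + (n : ZMod N), m⟩)
    = ncoeff k R ⟨s, n⟩ from LinearMap.congr_fun h x
  refine hom_ext_pathClass fun ⟨i, l⟩ => ?_
  rw [LinearMap.comp_apply, LinearMap.mulRight_apply,
    ncoeff_pathClass (h.of_isSubpath (isSubpath_prefix s (Nat.le_add_right n m)))]
  by_cases hc : i + (l : ZMod N) = s + (n : ZMod N)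
  · rw [← hc, pathClass_mul_pathClass, ncoeff_pathClass h]
    simp
  · rw [pathClass_mul_pathClass_of_ne hc, map_zero, if_neg]
    rintro ⟨⟩
    exact hc rfl

theorem ncoeff_mul_pathClass_of_ne {s t : ZMod N} {n m : ℕ} (hst : s + (n : ZMod N) ≠ t)
    (x : NakayamaAlgebra k R) :
    ncoeff k R ⟨s, n + m⟩ (x * pathClass k R ⟨t, m⟩) = 0 := by
  classical
  by_cases h : R.Avoids ⟨s, n + m⟩
  swap
  · exact ncoeff_of_not_avoids h _
  suffices h : ncoeff k R ⟨s, n + m⟩ ∘ₗ LinearMap.mulRight k (pathClass k R ⟨t, m⟩) = 0 from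
    LinearMap.congr_fun h x
  refine hom_ext_pathClass fun ⟨i, l⟩ => ?_
  rw [LinearMap.comp_apply, LinearMap.mulRight_apply, LinearMap.zero_apply]
  by_cases hc : i + (l : ZMod N) = t
  · rw [← hc, pathClass_mul_pathClass, ncoeff_pathClass h, if_neg]
    intro he
    simp only [CPath.mk.injEq, Nat.add_right_cancel_iff] at he
    rw [he.1, he.2] at hc
    exact hst hc
  · rw [pathClass_mul_pathClass_of_ne hc, map_zero]

theorem ncoeff_mul_pathClass_of_lt {s t : ZMod N} {l m : ℕ} (hlm : l < m)
    (x : NakayamaAlgebra k R) :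
    ncoeff k R ⟨s, l⟩ (x * pathClass k R ⟨t, m⟩) = 0 := by
  classical
  by_cases h : R.Avoids ⟨s, l⟩
  swap
  · exact ncoeff_of_not_avoids h _
  suffices h : ncoeff k R ⟨s, l⟩ ∘ₗ LinearMap.mulRight k (pathClass k R ⟨t, m⟩) = 0 from
    LinearMap.congr_fun h x
  refine hom_ext_pathClass fun ⟨i, n⟩ => ?_
  rw [LinearMap.comp_apply, LinearMap.mulRight_apply, LinearMap.zero_apply]
  by_cases hc : i + (n : ZMod N) = t
  · rw [← hc, pathClass_mul_pathClass, ncoeff_pathClass h, if_neg]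
    intro he
    simp only [CPath.mk.injEq] at he
    omega
  · rw [pathClass_mul_pathClass_of_ne hc, map_zero]

/-- Left multiplication by a path shifts the coefficients of paths that start with it. -/
theorem ncoeff_pathClass_mul {s : ZMod N} {n m : ℕ} (h : R.Avoids ⟨s, m + n⟩)
    (x : NakayamaAlgebra k R) :
    ncoeff k R ⟨s, m + n⟩ (pathClass k R ⟨s, m⟩ * x) = ncoeff k R ⟨s + (m : ZMod N), n⟩ x := by
  classical
  suffices h : ncoeff k R ⟨s, m + n⟩ ∘ₗ LinearMap.mulLeft k (pathClass k R ⟨s, m⟩)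
    = ncoeff k R ⟨s + (m : ZMod N), n⟩ from LinearMap.congr_fun h x
  refine hom_ext_pathClass fun ⟨i, l⟩ => ?_
  rw [LinearMap.comp_apply, LinearMap.mulLeft_apply,
    ncoeff_pathClass (h.of_isSubpath (isSubpath_suffix s m n))]
  by_cases hc : s + (m : ZMod N) = i
  · rw [← hc, pathClass_mul_pathClass, ncoeff_pathClass h]
    simp
  · rw [pathClass_mul_pathClass_of_ne hc, map_zero, if_neg]
    rintro ⟨⟩
    exact hc rfl

theorem idem_mul_idem (i : ZMod N) : idem k R i * idem k R i = idem k R i := by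
  have := pathClass_mul_pathClass (k := k) (R := R) i 0 0
  simpa [idem_eq] using this

theorem idem_mul_idem_of_ne {i j : ZMod N} (h : i ≠ j) : idem k R i * idem k R j = 0 :=
  pathClass_mul_pathClass_of_ne (by simpa using h)

theorem ncoeff_idem (i : ZMod N) : ncoeff k R ⟨i, 0⟩ (idem k R i) = 1 := by
  classical
  rw [idem_eq, ncoeff_pathClass (avoids_trivial R i), if_pos rfl]

theorem idem_ne_zero (i : ZMod N) : idem k R i ≠ 0 := by
  intro h
  have := ncoeff_idem (k := k) (R := R) i
  simp [h] at this

theorem ncoeff_idem_mul_of_ne {s i : ZMod N} (h : s ≠ i) (n : ℕ) (x : NakayamaAlgebra k R) :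
    ncoeff k R ⟨s, n⟩ (idem k R i * x) = 0 := by
  classical
  by_cases hs : R.Avoids ⟨s, n⟩
  swap
  · exact ncoeff_of_not_avoids hs _
  have := ncoeff_pathClass_mul (k := k) (R := R) (s := s) (m := 0) (n := n) (by simpa using hs)
    (idem k R i * x)
  rw [← mul_assoc, ← idem_eq, idem_mul_idem_of_ne h, zero_mul, map_zero] at this
  simpa using this.symm

/-- A trivial path factors only as its own square, so its coefficient is a character of Λ. -/
theorem ncoeff_mul_zero (i : ZMod N) (x y : NakayamaAlgebra k R) :
    ncoeff k R ⟨i, 0⟩ (x * y) = ncoeff k R ⟨i, 0⟩ x * ncoeff k R ⟨i, 0⟩ y := by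
  classical
  suffices h : ncoeff k R ⟨i, 0⟩ ∘ₗ LinearMap.mulLeft k x =
    ncoeff k R ⟨i, 0⟩ x • ncoeff k R ⟨i, 0⟩ from LinearMap.congr_fun h y
  refine hom_ext_pathClass fun ⟨j, l⟩ => ?_
  rw [LinearMap.comp_apply, LinearMap.mulLeft_apply, LinearMap.smul_apply, smul_eq_mul,
    ncoeff_pathClass (avoids_trivial R i)]
  rcases Nat.eq_zero_or_pos l with rfl | hl
  · by_cases hij : i = j
    · subst hij
      have := ncoeff_mul_pathClass (k := k) (R := R) (s := i) (n := 0) (m := 0)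
        (avoids_trivial R i) x
      simpa using this
    · rw [if_neg (by simpa using Ne.symm hij), mul_zero]
      exact ncoeff_mul_pathClass_of_ne (n := 0) (m := 0) (by simpa using hij) x
  · rw [ncoeff_mul_pathClass_of_lt hl, if_neg (by simp; omega), mul_zero]

instance : Module.Finite k (NakayamaAlgebra k R) := by
  let f : NakayamaAlgebra k R →ₗ[k] ((Σ i : ZMod N, Fin (R.projLength i)) → k) :=
    LinearMap.pi fun a => ncoeff k R ⟨a.1, a.2⟩
  refine Module.Finite.of_injective f fun x y h => nakayama_ext fun p hp => ?_
  exact congr_fun h ⟨p.source, p.length, (avoids_iff R _ _).1 hp⟩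

end Coefficients

/-! ### Socles and tops of the indecomposable projective modules -/

section Socle

variable {k : Type u} [Field k] {N : ℕ} [NeZero N] {R : Relations N}

theorem mem_proj_iff {i : ZMod N} {x : NakayamaAlgebra k R} :
    x ∈ proj k R i ↔ idem k R i * x = x := by
  rw [proj, Submodule.mem_span_singleton]
  constructor
  · rintro ⟨a, rfl⟩
    rw [MulOpposite.smul_eq_mul_unop, ← mul_assoc, idem_mul_idem]
  · intro h
    exact ⟨MulOpposite.op x, h⟩

theorem idem_mul_mem_proj (i : ZMod N) (x : NakayamaAlgebra k R) :
    idem k R i * x ∈ proj k R i := by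
  rw [mem_proj_iff, ← mul_assoc, idem_mul_idem]

theorem idem_mem_proj (i : ZMod N) : idem k R i ∈ proj k R i :=
  mem_proj_iff.2 (idem_mul_idem i)

theorem idem_mul_pathClass (i : ZMod N) (n : ℕ) :
    idem k R i * pathClass k R ⟨i, n⟩ = pathClass k R ⟨i, n⟩ := by
  simpa [idem_eq] using pathClass_mul_pathClass (k := k) (R := R) i 0 n

theorem pathClass_mem_proj (i : ZMod N) (n : ℕ) : pathClass k R ⟨i, n⟩ ∈ proj k R i :=
  mem_proj_iff.2 (idem_mul_pathClass i n)

theorem ncoeff_proj_of_ne {s i : ZMod N} (h : s ≠ i) (n : ℕ) {x : NakayamaAlgebra k R}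
    (hx : x ∈ proj k R i) : ncoeff k R ⟨s, n⟩ x = 0 := by
  rw [← mem_proj_iff.1 hx, ncoeff_idem_mul_of_ne h]

theorem proj_ext {i : ZMod N} {x y : NakayamaAlgebra k R} (hx : x ∈ proj k R i)
    (hy : y ∈ proj k R i) (h : ∀ n < R.projLength i, ncoeff k R ⟨i, n⟩ x = ncoeff k R ⟨i, n⟩ y) :
    x = y := by
  refine nakayama_ext fun ⟨s, n⟩ hp => ?_
  by_cases hs : s = i
  · subst hs
    exact h n ((avoids_iff R _ _).1 hp)
  · rw [ncoeff_proj_of_ne hs n hx, ncoeff_proj_of_ne hs n hy]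

theorem mul_mem_proj {i : ZMod N} {x : NakayamaAlgebra k R} (hx : x ∈ proj k R i)
    (y : NakayamaAlgebra k R) : x * y ∈ proj k R i :=
  (proj k R i).smul_mem (MulOpposite.op y) hx

theorem smul_mem_of_submodule {M : Type*} [AddCommGroup M] [Module (NakayamaAlgebra k R)ᵐᵒᵖ M]
    [Module k M] [IsScalarTower k (NakayamaAlgebra k R)ᵐᵒᵖ M]
    (T : Submodule (NakayamaAlgebra k R)ᵐᵒᵖ M) (a : k) {x : M} (hx : x ∈ T) : a • x ∈ T := by
  rw [← one_smul (NakayamaAlgebra k R)ᵐᵒᵖ x, ← smul_assoc]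
  exact T.smul_mem _ hx

variable (k R) in
/-- The last nonzero path in `P i`. -/
def lastPath (i : ZMod N) : NakayamaAlgebra k R := pathClass k R ⟨i, R.projLength i - 1⟩

theorem lastPath_mem_proj (i : ZMod N) : lastPath k R i ∈ proj k R i := pathClass_mem_proj i _

theorem avoids_lastPath (i : ZMod N) : R.Avoids ⟨i, R.projLength i - 1⟩ :=
  (avoids_iff R _ _).2 (Nat.sub_lt (projLength_pos R i) one_pos)

theorem lastPath_ne_zero (i : ZMod N) : lastPath k R i ≠ 0 := by
  classical
  intro h
  have := ncoeff_pathClass (k := k) (avoids_lastPath (R := R) i) ⟨i, R.projLength i - 1⟩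
  rw [← lastPath, h] at this
  simp at this

theorem lastPath_mul_idem (i : ZMod N) :
    lastPath k R i * idem k R (R.socleVertex i) = lastPath k R i :=
  pathClass_mul_pathClass i _ 0

theorem lastPath_mul_idem_of_ne {i j : ZMod N} (h : R.socleVertex i ≠ j) :
    lastPath k R i * idem k R j = 0 := pathClass_mul_pathClass_of_ne h

/-- The algebra acts on the last nonzero path through a character. -/
theorem lastPath_mul (i : ZMod N) (x : NakayamaAlgebra k R) :
    lastPath k R i * x = ncoeff k R ⟨R.socleVertex i, 0⟩ x • lastPath k R i := by
  classical
  suffices h : LinearMap.mulLeft k (lastPath k R i) =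
    (ncoeff k R ⟨R.socleVertex i, 0⟩).smulRight (lastPath k R i) from LinearMap.congr_fun h x
  refine hom_ext_pathClass fun ⟨j, l⟩ => ?_
  rw [LinearMap.mulLeft_apply, LinearMap.smulRight_apply,
    ncoeff_pathClass (avoids_trivial R _)]
  by_cases hj : R.socleVertex i = j
  · subst hj
    rcases Nat.eq_zero_or_pos l with rfl | hl
    · rw [if_pos rfl, one_smul]
      exact lastPath_mul_idem i
    · rw [if_neg (by simp; omega), zero_smul, lastPath, Relations.socleVertex,
        pathClass_mul_pathClass, pathClass_eq_zero]
      rw [avoids_iff]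
      omega
  · rw [if_neg (by simp [Ne.symm hj]), zero_smul]
    exact pathClass_mul_pathClass_of_ne hj

/-- Every nonzero element of `P i` has a multiple that is the last path. -/
theorem exists_mul_eq_lastPath {i : ZMod N} {x : NakayamaAlgebra k R} (hx : x ∈ proj k R i)
    (h0 : x ≠ 0) : ∃ y, x * y = lastPath k R i := by
  classical
  have hex : ∃ n, ncoeff k R ⟨i, n⟩ x ≠ 0 := by
    by_contra! h
    exact h0 (proj_ext hx (zero_mem _) fun n _ => by rw [h, map_zero])
  let n := Nat.find hex
  have hn : ncoeff k R ⟨i, n⟩ x ≠ 0 := Nat.find_spec hex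
  have hmin : ∀ m < n, ncoeff k R ⟨i, m⟩ x = 0 := fun m hm => not_not.1 (Nat.find_min hex hm)
  have hlt : n < R.projLength i := by
    rw [← avoids_iff]
    by_contra h
    exact hn (ncoeff_of_not_avoids h x)
  obtain ⟨m, hm⟩ := Nat.exists_eq_add_of_lt hlt
  -- The shortest path occurring in `x` has length `n`, and `m` more arrows complete it to the last
  -- path. Every longer path in `x` is pushed past the length of P_i and dies.
  have key : x * pathClass k R ⟨i + (n : ZMod N), m⟩ =
      ncoeff k R ⟨i, n⟩ x • lastPath k R i := by
    refine proj_ext (mul_mem_proj hx _)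
      (smul_mem_of_submodule _ _ (lastPath_mem_proj i)) fun l hl => ?_
    have hal := (avoids_iff R i l).2 hl
    rw [map_smul, lastPath, ncoeff_pathClass hal]
    rcases lt_or_ge l m with hlm | hlm
    · rw [ncoeff_mul_pathClass_of_lt hlm, if_neg (by simp; omega), smul_zero]
    · obtain ⟨d, rfl⟩ := Nat.exists_eq_add_of_le' hlm
      rcases eq_or_ne d n with rfl | hd
      · rw [ncoeff_mul_pathClass hal, if_pos (by simp; omega), smul_eq_mul, mul_one]
      · rw [if_neg (by simp; omega), smul_zero]
        by_cases hc : i + (d : ZMod N) = i + (n : ZMod N)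
        · rw [← hc, ncoeff_mul_pathClass hal, hmin d (by omega)]
        · exact ncoeff_mul_pathClass_of_ne hc x
  refine ⟨(ncoeff k R ⟨i, n⟩ x)⁻¹ • pathClass k R ⟨i + (n : ZMod N), m⟩, ?_⟩
  rw [mul_smul_comm, key, smul_smul, inv_mul_cancel₀ hn, one_smul]

variable (k R) in
/-- Left multiplication by the last path of `P i`, as a map from the projective module at its
end point to `P i`. -/
def lastPathHom (i j : ZMod N) :
    proj k R j →ₗ[(NakayamaAlgebra k R)ᵐᵒᵖ] proj k R i where
  toFun x := ⟨lastPath k R i * x, mul_mem_proj (lastPath_mem_proj i) _⟩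
  map_add' _ _ := Subtype.ext (mul_add _ _ _)
  map_smul' _ _ := Subtype.ext (mul_assoc _ _ _).symm

theorem lastPathHom_apply (i j : ZMod N) (x : proj k R j) :
    (lastPathHom k R i j x : NakayamaAlgebra k R) = lastPath k R i * x := rfl

theorem mem_range_lastPathHom {i : ZMod N} {x : proj k R i} :
    x ∈ LinearMap.range (lastPathHom k R i (R.socleVertex i)) ↔
      ∃ a : k, (x : NakayamaAlgebra k R) = a • lastPath k R i := by
  constructor
  · rintro ⟨y, rfl⟩
    exact ⟨_, lastPath_mul i (y : NakayamaAlgebra k R)⟩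
  · rintro ⟨a, ha⟩
    refine ⟨⟨a • idem k R _, smul_mem_of_submodule _ _ (idem_mem_proj _)⟩, Subtype.ext ?_⟩
    rw [lastPathHom_apply, ha, mul_smul_comm, lastPath_mul_idem]

/-- Any nonzero element generates a submodule containing the last path. The line it spans is thus
the least nonzero submodule, hence the only simple one. -/
theorem range_lastPathHom_le {i : ZMod N}
    {T : Submodule (NakayamaAlgebra k R)ᵐᵒᵖ (proj k R i)} (hT : T ≠ ⊥) :
    LinearMap.range (lastPathHom k R i (R.socleVertex i)) ≤ T := by
  obtain ⟨x, hx, h0⟩ := (Submodule.ne_bot_iff T).1 hT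
  obtain ⟨y, hy⟩ := exists_mul_eq_lastPath x.2 (fun h => h0 (Subtype.ext h))
  intro z hz
  obtain ⟨a, ha⟩ := mem_range_lastPathHom.1 hz
  have h : z = MulOpposite.op (a • y) • x := by
    refine Subtype.ext ?_
    rw [ha, ← hy, ← mul_smul_comm]
    rfl
  rw [h]
  exact T.smul_mem _ hx

theorem range_lastPathHom_ne_bot (i : ZMod N) :
    LinearMap.range (lastPathHom k R i (R.socleVertex i)) ≠ ⊥ := by
  refine (Submodule.ne_bot_iff _).2 ⟨⟨lastPath k R i, lastPath_mem_proj i⟩,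
    mem_range_lastPathHom.2 ⟨1, (one_smul _ _).symm⟩, fun h => lastPath_ne_zero (k := k) (R := R) i ?_⟩
  exact congr_arg Subtype.val h

theorem socle_proj (i : ZMod N) :
    socle (NakayamaAlgebra k R)ᵐᵒᵖ (proj k R i) =
      LinearMap.range (lastPathHom k R i (R.socleVertex i)) := by
  refine le_antisymm (sSup_le fun T hT => ?_) (le_sSup ?_)
  · have hT : IsSimpleModule _ T := hT
    have hat := isSimpleModule_iff_isAtom.1 hT
    rcases hat.le_iff.1 (range_lastPathHom_le hat.1) with h | h
    · exact absurd h (range_lastPathHom_ne_bot i)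
    · exact h.ge
  · refine isSimpleModule_iff_isAtom.2 ⟨range_lastPathHom_ne_bot i, fun T hT => ?_⟩
    by_contra h
    exact hT.not_ge (range_lastPathHom_le h)

theorem mem_ker_lastPathHom {i : ZMod N} {x : proj k R (R.socleVertex i)} :
    x ∈ LinearMap.ker (lastPathHom k R i (R.socleVertex i)) ↔
      ncoeff k R ⟨R.socleVertex i, 0⟩ (x : NakayamaAlgebra k R) = 0 := by
  rw [LinearMap.mem_ker, ← Subtype.coe_inj, lastPathHom_apply, lastPath_mul]
  simp [lastPath_ne_zero]

/-- A submodule of `P i` that contains an element with nonzero coefficient at the trivial path is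
the whole module. -/
theorem eq_top_of_ncoeff_ne_zero {i : ZMod N}
    {T : Submodule (NakayamaAlgebra k R)ᵐᵒᵖ (proj k R i)} {x : proj k R i} (hx : x ∈ T)
    (h : ncoeff k R ⟨i, 0⟩ (x : NakayamaAlgebra k R) ≠ 0) : T = ⊤ := by
  classical
  set c := ncoeff k R ⟨i, 0⟩ (x : NakayamaAlgebra k R)
  -- Successive approximation: `l` bounds from below the lengths of the paths in `y`, and `d` bounds
  -- the number of steps left. Each step subtracts the multiple `z` of `x` that cancels the
  -- coefficient at length `l`.
  suffices key : ∀ d l, R.projLength i ≤ l + d → ∀ y : proj k R i,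
      (∀ m < l, ncoeff k R ⟨i, m⟩ (y : NakayamaAlgebra k R) = 0) → y ∈ T from
    (Submodule.eq_top_iff').2 fun y => key _ 0 (zero_add _).ge y fun m hm => by omega
  intro d
  induction d with
  | zero =>
    intro l hl y hy
    have : y = 0 := Subtype.ext (proj_ext y.2 (zero_mem _) fun n hn => by
      rw [hy n (by omega), Submodule.coe_zero, map_zero])
    rw [this]
    exact zero_mem _
  | succ d ih =>
    intro l hl y hy
    let a := ncoeff k R ⟨i, l⟩ (y : NakayamaAlgebra k R)
    let z : proj k R i := MulOpposite.op ((a * c⁻¹) • pathClass k R ⟨i, l⟩) • x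
    have hz : z ∈ T := T.smul_mem _ hx
    rw [← sub_add_cancel y z]
    refine add_mem (ih (l + 1) (by omega) _ fun m hm => ?_) hz
    have hzv : (z : NakayamaAlgebra k R) = (a * c⁻¹) • (x * pathClass k R ⟨i, l⟩) :=
      mul_smul_comm _ _ _
    rw [Submodule.coe_sub, map_sub, hzv, map_smul, smul_eq_mul, sub_eq_zero]
    rcases Nat.lt_succ_iff_lt_or_eq.1 hm with hm | rfl
    · rw [hy m hm, ncoeff_mul_pathClass_of_lt hm, mul_zero]
    · by_cases hal : R.Avoids ⟨i, m⟩
      · have := ncoeff_mul_pathClass (k := k) (R := R) (s := i) (n := 0) (m := m)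
          (by simpa using hal) x
        simp only [Nat.cast_zero, add_zero, zero_add] at this
        rw [this, inv_mul_cancel_right₀ h]
      · rw [ncoeff_of_not_avoids hal, ncoeff_of_not_avoids hal, mul_zero]

variable (k R) in
/-- The submodule of `P i` spanned by the paths of positive length. -/
def projRadical (i : ZMod N) : Submodule (NakayamaAlgebra k R)ᵐᵒᵖ (proj k R i) where
  carrier := {x | ncoeff k R ⟨i, 0⟩ (x : NakayamaAlgebra k R) = 0}
  add_mem' {x y} hx hy := by
    simp only [Set.mem_ofPred_eq] at *
    rw [Submodule.coe_add, map_add, hx, hy, add_zero]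
  zero_mem' := map_zero _
  smul_mem' a x hx := by
    have h := ncoeff_mul_zero i (x : NakayamaAlgebra k R) a.unop
    rwa [hx, zero_mul] at h

theorem mem_projRadical {i : ZMod N} {x : proj k R i} :
    x ∈ projRadical k R i ↔ ncoeff k R ⟨i, 0⟩ (x : NakayamaAlgebra k R) = 0 := Iff.rfl

theorem idem_notMem_projRadical (i : ZMod N) :
    (⟨idem k R i, idem_mem_proj i⟩ : proj k R i) ∉ projRadical k R i := by
  rw [mem_projRadical, ncoeff_idem]
  exact one_ne_zero

theorem le_projRadical {i : ZMod N} {T : Submodule (NakayamaAlgebra k R)ᵐᵒᵖ (proj k R i)}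
    (hT : T ≠ ⊤) : T ≤ projRadical k R i := fun _ hx =>
  by_contra fun h => hT (eq_top_of_ncoeff_ne_zero hx h)

/-- By `le_projRadical`, `projRadical` contains every proper submodule, so it is the unique maximal
one. -/
theorem jacobson_proj (i : ZMod N) :
    Module.jacobson (NakayamaAlgebra k R)ᵐᵒᵖ (proj k R i) = projRadical k R i := by
  have htop : projRadical k R i ≠ ⊤ := fun h =>
    idem_notMem_projRadical (k := k) (R := R) i (h ▸ Submodule.mem_top)
  refine le_antisymm (sInf_le ⟨htop, fun T hT => ?_⟩) (le_sInf fun T hT => ?_)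
  · by_contra h
    exact hT.not_ge (le_projRadical h)
  · by_contra h
    have h1 := hT.2 (T ⊔ projRadical k R i) (left_lt_sup.2 h)
    rw [sup_eq_right.2 (le_projRadical hT.1)] at h1
    exact htop h1

/-- The idempotent at `j` fixes a generator of S_j but kills the socle of P_i unless the last path
ends at `j`. Conversely, left multiplication by the last path has the socle as image and the radical
as kernel. -/
theorem nonempty_socle_equiv_iff (i j : ZMod N) :
    Nonempty (socle (NakayamaAlgebra k R)ᵐᵒᵖ (proj k R i)
      ≃ₗ[(NakayamaAlgebra k R)ᵐᵒᵖ] simpleModule k R j) ↔ R.socleVertex i = j := by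
  constructor
  · rintro ⟨φ⟩
    by_contra hij
    let v : simpleModule k R j := Submodule.Quotient.mk ⟨idem k R j, idem_mem_proj j⟩
    have hv : MulOpposite.op (idem k R j) • v = v := by
      change Submodule.Quotient.mk _ = _
      congr 1
      exact Subtype.ext (idem_mul_idem j)
    have hv0 : v ≠ 0 := by
      rw [Ne, Submodule.Quotient.mk_eq_zero, jacobson_proj]
      exact idem_notMem_projRadical j
    have h1 : MulOpposite.op (idem k R j) • φ.symm v = φ.symm v := by rw [← map_smul, hv]
    obtain ⟨a, ha⟩ := mem_range_lastPathHom.1 ((socle_proj (k := k) (R := R) i).le (φ.symm v).2)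
    have h2 : MulOpposite.op (idem k R j) • φ.symm v = 0 := by
      refine Subtype.ext (Subtype.ext ?_)
      change ((φ.symm v : proj k R i) : NakayamaAlgebra k R) * idem k R j = 0
      rw [ha, smul_mul_assoc, lastPath_mul_idem_of_ne hij, smul_zero]
    rw [h2] at h1
    exact hv0 (φ.symm.map_eq_zero_iff.1 h1.symm)
  · rintro rfl
    have h : Module.jacobson (NakayamaAlgebra k R)ᵐᵒᵖ (proj k R (R.socleVertex i)) =
        LinearMap.ker (lastPathHom k R i (R.socleVertex i)) := by
      rw [jacobson_proj]
      ext x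
      rw [mem_projRadical, mem_ker_lastPathHom]
    exact ⟨(LinearEquiv.ofEq _ _ (socle_proj i)).trans
      ((lastPathHom k R i (R.socleVertex i)).quotKerEquivRange.symm.trans
        (Submodule.quotEquivOfEq _ _ h.symm))⟩

variable (k R) in
theorem socleVertices_eq : socleVertices k R = Set.range R.socleVertex := by
  ext j
  simp only [socleVertices, Set.mem_ofPred_eq, nonempty_socle_equiv_iff, Set.mem_range]

theorem shiftedSocleVertices_eq_univ_iff :
    shiftedSocleVertices k R = Set.univ ↔ Function.Surjective R.socleVertex := by
  rw [shiftedSocleVertices, socleVertices_eq, ← Set.range_eq_univ]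
  constructor
  · intro h
    rw [Set.eq_univ_iff_forall] at h ⊢
    intro j
    obtain ⟨i, hi, hij⟩ := h (j + 1)
    rwa [← add_right_cancel hij]
  · intro h
    rw [h, Set.image_univ]
    exact (Equiv.addRight (1 : ZMod N)).surjective.range_eq

end Socle

/-! ### Self-injectivity -/

/-- An algebra over a field with a linear form whose associated bilinear form is perfect is
injective as a right module over itself. -/
theorem injective_of_perfect_form {k A : Type*} [Field k] [Ring A] [Algebra k A] (ℓ : A →ₗ[k] k)
    (hℓ : Function.Bijective fun x : A => ℓ ∘ₗ LinearMap.mulLeft k x) :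
    Module.Injective Aᵐᵒᵖ A := by
  refine Module.Baer.injective fun I g => ?_
  -- Extend ℓ ∘ g to a functional φ by linear algebra, then let `h y` represent a ↦ φ(ya) through
  -- the form. Uniqueness of representatives makes `h` linear over the algebra and equal to `g` on
  -- `I`.
  let gk : I.restrictScalars k →ₗ[k] k := ℓ ∘ₗ (g.restrictScalars k : I →ₗ[k] A)
  obtain ⟨φ, hφ⟩ := gk.exists_extend
  have hφ' : ∀ (x : Aᵐᵒᵖ) (hx : x ∈ I), φ x = ℓ (g ⟨x, hx⟩) := fun x hx =>
    LinearMap.congr_fun hφ ⟨x, hx⟩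
  let ψ : Aᵐᵒᵖ → (A →ₗ[k] k) := fun y =>
    φ ∘ₗ LinearMap.mulRight k y ∘ₗ (MulOpposite.opLinearEquiv k).toLinearMap
  have hψ : ∀ y a, ψ y a = φ (MulOpposite.op a * y) := fun _ _ => rfl
  choose h hh using fun y => hℓ.2 (ψ y)
  have hh' : ∀ y a, ℓ (h y * a) = φ (MulOpposite.op a * y) := fun y a =>
    (LinearMap.congr_fun (hh y) a).trans (hψ y a)
  have huniq : ∀ x y : A, (∀ a, ℓ (x * a) = ℓ (y * a)) → x = y := fun x y hxy =>
    hℓ.1 (LinearMap.ext hxy)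
  refine ⟨{ toFun := h, map_add' := fun y z => huniq _ _ fun a => ?_,
            map_smul' := fun b y => huniq _ _ fun a => ?_ }, fun x hx => huniq _ _ fun a => ?_⟩
  · rw [add_mul, map_add, hh', hh', hh', mul_add, map_add]
  · rw [hh', RingHom.id_apply, MulOpposite.smul_eq_mul_unop, mul_assoc, hh', smul_eq_mul,
      ← mul_assoc, MulOpposite.op_mul, MulOpposite.op_unop]
  · have h1 := hφ' _ (I.mul_mem_left (MulOpposite.op a) hx)
    change ℓ (h x * a) = _
    rw [hh', h1]
    exact congr_arg ℓ (g.map_smul (MulOpposite.op a) ⟨x, hx⟩)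

section

variable {k : Type u} [Field k] {N : ℕ} [NeZero N] {R : Relations N}

/-- With all lengths equal to c + 1, every nonzero path extends on the right to one of length c.
Multiplying by the extending path lets ℓ read off any coefficient, so the form is nondegenerate,
hence perfect in finite dimension. -/
theorem injective_of_projLength_eq (h : ∀ i j, R.projLength i = R.projLength j) :
    Module.Injective (NakayamaAlgebra k R)ᵐᵒᵖ (NakayamaAlgebra k R) := by
  obtain ⟨c, hc⟩ : ∃ c, R.projLength 0 = c + 1 :=
    Nat.exists_eq_succ_of_ne_zero (projLength_pos R 0).ne'
  replace hc : ∀ i, R.projLength i = c + 1 := fun i => (h i 0).trans hc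
  let ℓ : NakayamaAlgebra k R →ₗ[k] k := ∑ s, ncoeff k R ⟨s, c⟩
  have hℓ : ∀ x, ℓ x = ∑ s, ncoeff k R ⟨s, c⟩ x := fun x => LinearMap.sum_apply _ _ _
  let Φ : NakayamaAlgebra k R →ₗ[k] (NakayamaAlgebra k R →ₗ[k] k) :=
    (LinearMap.llcomp k _ _ _ ℓ) ∘ₗ (LinearMap.mul k (NakayamaAlgebra k R))
  have hΦ : Function.Injective Φ := by
    rw [injective_iff_map_eq_zero]
    intro x hx
    refine nakayama_ext fun ⟨s, n⟩ hp => ?_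
    rw [map_zero]
    have hn := (avoids_iff R s n).1 hp
    rw [hc] at hn
    obtain ⟨m, rfl⟩ := Nat.exists_eq_add_of_le (Nat.lt_succ_iff.1 hn)
    have h1 : ℓ (x * pathClass k R ⟨s + (n : ZMod N), m⟩) = 0 := LinearMap.congr_fun hx _
    rw [hℓ, Finset.sum_eq_single s, ncoeff_mul_pathClass] at h1
    · exact h1
    · rw [avoids_iff, hc]
      omega
    · intro t _ hts
      exact ncoeff_mul_pathClass_of_ne (fun he => hts (add_right_cancel he)) x
    · simp
  have hbij : Function.Bijective Φ :=
    ⟨hΦ, (LinearMap.injective_iff_surjective_of_finrank_eq_finrank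
      (Subspace.dual_finrank_eq (K := k) (V := NakayamaAlgebra k R)).symm).1 hΦ⟩
  exact injective_of_perfect_form ℓ hbij

end

section SelfInjective

variable {k : Type u} [Field k] {N : ℕ} [NeZero N] {R : Relations N}

theorem ne_succ_of_injective
    [Module.Injective (NakayamaAlgebra k R)ᵐᵒᵖ (NakayamaAlgebra k R)] (i : ZMod N) :
    R.projLength i ≠ R.projLength (i + 1) + 1 := by
  intro hi
  let A := NakayamaAlgebra k R
  let f : proj k R (i + 1) →ₗ[Aᵐᵒᵖ] A :=
    (AlgEquiv.moduleEndSelfOp k (pathClass k R ⟨i, 1⟩)) ∘ₗ (proj k R (i + 1)).subtype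
  have hf : ∀ x, f x = pathClass k R ⟨i, 1⟩ * (x : A) := fun x => rfl
  have hinj : Function.Injective f := by
    rw [injective_iff_map_eq_zero]
    intro x hx
    -- By `hi`, a nonzero path from `i + 1` stays nonzero when α_i is put in front.
    refine Subtype.ext (proj_ext x.2 (zero_mem _) fun n hn => ?_)
    have h1 := ncoeff_pathClass_mul (k := k) (R := R) (s := i) (m := 1) (n := n)
      ((avoids_iff R _ _).2 (by omega)) x
    rw [← hf, hx, map_zero, Nat.cast_one] at h1
    rw [← h1, Submodule.coe_zero, map_zero]
  obtain ⟨g, hg⟩ := Module.Injective.out f hinj (proj k R (i + 1)).subtype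
  have h1 : g (pathClass k R ⟨i, 1⟩) = idem k R (i + 1) := by
    have h2 := hg ⟨idem k R (i + 1), idem_mem_proj _⟩
    rw [hf] at h2
    have h3 := pathClass_mul_pathClass (k := k) (R := R) i 1 0
    rw [Nat.cast_one, ← idem_eq] at h3
    rwa [h3] at h2
  have h2 : g (pathClass k R ⟨i, 1⟩) = g 1 * pathClass k R ⟨i, 1⟩ := by
    rw [← MulOpposite.unop_op (pathClass k R ⟨i, 1⟩), ← MulOpposite.smul_eq_mul_unop, ← map_smul,
      MulOpposite.smul_eq_mul_unop, one_mul]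
  have h3 := ncoeff_idem (k := k) (R := R) (i + 1)
  -- A left multiple of an arrow has no trivial path in its expansion.
  rw [← h1, h2, ncoeff_mul_pathClass_of_lt one_pos] at h3
  exact zero_ne_one h3

end SelfInjective

/-! ### The syzygy filtered algebra -/

section Syzygy

variable {k : Type u} [Field k] {N : ℕ} [NeZero N] {R : Relations N}

open Classical in
variable (k R) in
/-- The map from a direct sum of modules `P i` to the algebra given by the inclusions. -/
def projSum (S : Set (ZMod N)) :
    (⨁ i : S, proj k R i) →ₗ[(NakayamaAlgebra k R)ᵐᵒᵖ] NakayamaAlgebra k R :=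
  DirectSum.toModule _ _ _ fun i => (proj k R i).subtype

open Classical in
theorem projSum_of (S : Set (ZMod N)) (i : S) (x : proj k R i) :
    projSum k R S (DirectSum.lof (NakayamaAlgebra k R)ᵐᵒᵖ S (fun i : S => proj k R i) i x) = x :=
  DirectSum.toModule_lof _ _ _

theorem idem_mul_projSum (S : Set (ZMod N)) (i : S) (x : ⨁ i : S, proj k R i) :
    idem k R i * projSum k R S x = x i := by
  classical
  induction x using DirectSum.induction_on with
  | zero => simp
  | of j x =>
    have h := projSum_of S j x
    rw [DirectSum.lof_eq_of] at h
    rw [h]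
    by_cases hij : i = j
    · subst hij
      rw [DirectSum.of_eq_same, mem_proj_iff.1 x.2]
    · rw [DirectSum.of_eq_of_ne _ _ _ hij, ← mem_proj_iff.1 x.2, ← mul_assoc,
        idem_mul_idem_of_ne (fun h => hij (Subtype.ext h)), zero_mul, Submodule.coe_zero]
  | add x y hx hy => rw [map_add, mul_add, hx, hy, DirectSum.add_apply, Submodule.coe_add]

theorem idem_mul_projSum_of_notMem (S : Set (ZMod N)) {i : ZMod N} (hi : i ∉ S)
    (x : ⨁ i : S, proj k R i) : idem k R i * projSum k R S x = 0 := by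
  classical
  induction x using DirectSum.induction_on with
  | zero => simp
  | of j x =>
    have h := projSum_of S j x
    rw [DirectSum.lof_eq_of] at h
    rw [h, ← mem_proj_iff.1 x.2, ← mul_assoc,
        idem_mul_idem_of_ne (fun h : i = j => hi (h.symm ▸ j.2)), zero_mul]
  | add x y hx hy => rw [map_add, mul_add, hx, hy, add_zero]

/-- Left multiplication by the idempotents recovers the components. -/
theorem projSum_injective (S : Set (ZMod N)) : Function.Injective (projSum k R S) := by
  intro x y h
  refine DFinsupp.ext fun i => Subtype.ext ?_
  rw [← idem_mul_projSum, ← idem_mul_projSum, h]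

theorem projSum_surjective {S : Set (ZMod N)} (hS : S = Set.univ) :
    Function.Surjective (projSum k R S) := by
  classical
  intro y
  refine ⟨∑ i : ZMod N, DirectSum.lof (NakayamaAlgebra k R)ᵐᵒᵖ S (fun i : S => proj k R i)
    ⟨i, hS ▸ Set.mem_univ i⟩ ⟨idem k R i * y, idem_mul_mem_proj i y⟩, ?_⟩
  rw [map_sum, Finset.sum_congr rfl fun i _ => projSum_of S ⟨i, hS ▸ Set.mem_univ i⟩
    ⟨idem k R i * y, idem_mul_mem_proj i y⟩, ← Finset.sum_mul, ← one_eq_sum_idem, one_mul]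

theorem nonempty_algEquiv_end_projSum {S : Set (ZMod N)} (hS : S = Set.univ) :
    Nonempty (NakayamaAlgebra k R ≃ₐ[k]
      Module.End (NakayamaAlgebra k R)ᵐᵒᵖ (⨁ i : S, proj k R i)) :=
  ⟨(AlgEquiv.moduleEndSelfOp k).trans (LinearEquiv.conjAlgEquiv k
    (LinearEquiv.ofBijective (projSum k R S)
      ⟨projSum_injective S, projSum_surjective hS⟩)).symm⟩

variable (k R) in
/-- The sum of the generators `e i` of the summands `P i`. -/
def projSumGen (S : Set (ZMod N)) : ⨁ i : S, proj k R i := by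
  classical
  exact ∑ i : S, DirectSum.lof (NakayamaAlgebra k R)ᵐᵒᵖ S (fun i : S => proj k R i) i
    ⟨idem k R i, idem_mem_proj _⟩

theorem eq_zero_of_map_projSumGen {S : Set (ZMod N)}
    {φ : Module.End (NakayamaAlgebra k R)ᵐᵒᵖ (⨁ i : S, proj k R i)}
    (h : φ (projSumGen k R S) = 0) : φ = 0 := by
  classical
  -- Inside Λ the generator is e = ∑ e_i over `S`, and this reads e·x = x for x in eΛ.
  have key : ∀ x, MulOpposite.op (projSum k R S x) • projSumGen k R S = x := by
    intro x
    apply projSum_injective S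
    rw [map_smul, projSumGen, map_sum]
    simp only [projSum_of]
    rw [MulOpposite.smul_eq_mul_unop, MulOpposite.unop_op, Finset.sum_mul]
    simp only [idem_mul_projSum]
    conv_rhs => rw [← one_mul (projSum k R S x), one_eq_sum_idem, Finset.sum_mul]
    rw [← Finset.sum_subset (Finset.subset_univ (Finset.univ.filter (· ∈ S)))]
    · rw [← Finset.sum_subtype_eq_sum_filter, Finset.subtype_univ]
      simp only [idem_mul_projSum]
    · intro i _ hi
      exact idem_mul_projSum_of_notMem S (by simpa using hi) x
  refine LinearMap.ext fun x => ?_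
  rw [← key x, map_smul, h, smul_zero, LinearMap.zero_apply]

/-- Only the k-linearity and injectivity of `e` matter: evaluation at the generator makes Λ embed in
itself with image in the sum of the P_i, i ∈ `S`. By finite dimension this image is all of Λ, so no
idempotent can be missing. -/
theorem eq_univ_of_algEquiv {S : Set (ZMod N)}
    (e : NakayamaAlgebra k R ≃ₐ[k]
      Module.End (NakayamaAlgebra k R)ᵐᵒᵖ (⨁ i : S, proj k R i)) : S = Set.univ := by
  let f : NakayamaAlgebra k R →ₗ[k] NakayamaAlgebra k R :=
    { toFun := fun x => projSum k R S (e x (projSumGen k R S))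
      map_add' := fun x y => by rw [map_add, LinearMap.add_apply, map_add]
      map_smul' := fun a x => by
        rw [map_smul, LinearMap.smul_apply, RingHom.id_apply]
        exact (projSum k R S).map_smul_of_tower a _ }
  have hinj : Function.Injective f := by
    rw [injective_iff_map_eq_zero]
    intro x hx
    have h1 : e x (projSumGen k R S) = 0 := projSum_injective S (hx.trans (map_zero _).symm)
    exact (map_eq_zero_iff e e.injective).1 (eq_zero_of_map_projSumGen h1)
  rw [Set.eq_univ_iff_forall]
  intro i
  by_contra hi
  obtain ⟨x, hx⟩ := LinearMap.injective_iff_surjective.1 hinj (idem k R i)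
  have h1 : idem k R i * f x = 0 := idem_mul_projSum_of_notMem S hi _
  rw [hx, idem_mul_idem] at h1
  exact idem_ne_zero i h1

end Syzygy

end CyclicNakayama
end

theorem mainTheorem5 (k : Type u) [Field k] (N : ℕ) [NeZero N] (hN : 2 ≤ N)
    (R : CyclicNakayama.Relations N) :
    Nonempty (CyclicNakayama.NakayamaAlgebra k R ≃ₐ[k]
      CyclicNakayama.SyzygyFilteredAlgebra k R) ↔
    Module.Injective (CyclicNakayama.NakayamaAlgebra k R)ᵐᵒᵖ
      (CyclicNakayama.NakayamaAlgebra k R) := by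
  open CyclicNakayama in
  constructor
  · rintro ⟨e⟩
    have h := shiftedSocleVertices_eq_univ_iff.1 (eq_univ_of_algEquiv e)
    exact injective_of_projLength_eq (projLength_eq_of_ne_succ R
      (ne_succ_of_socleVertex_injective R hN (Finite.injective_iff_surjective.2 h)))
  · intro hinj
    have hc := projLength_eq_of_ne_succ R (ne_succ_of_injective (k := k) (R := R))
    refine nonempty_algEquiv_end_projSum (shiftedSocleVertices_eq_univ_iff.2 fun j => ?_)
    -- For constant lengths `socleVertex` is a translation; the witness is its inverse at `j`.
    refine ⟨j - ((R.projLength 0 - 1 : ℕ) : ZMod N), ?_⟩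
    rw [Relations.socleVertex, hc (j - _) 0, sub_add_cancel]
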